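/- Let $\mathbb F$ be a field with a non-trivial automorphism $\sigma$ of order $2$, written $\bar a=\sigma(a)$, and let $\mathbb F_0=\{a\in\mathbb F : \bar a=a\}$ be its fixed field. Let $V$ be a finite-dimensional $\mathbb F$-vector space with a non-degenerate hermitian form $B\colon V\times V\to\mathbb F$, that is, $B$ is linear in the first coordinate and $B(u,v)=\overline{B(v,u)}$ for all $u,v\in V$. Let $$U(V,B)=\{g\in GL(V) \mid B(u,v)=B(g(u),g(v))\ \text{for all } u,v\in V\}$$ be its unitary group. Suppose that $\mathbb F_0$ has property FE: it is a perfect field of characteristic $\neq 2$ and, for every integer $n\geq 1$, it has only finitely many field extensions of degree $n$ up to isomorphism over $\mathbb F_0$. Then the number of conjugacy classes of unipotent elements in $U(V,B)$ is finite (an element $g$ is unipotent if $g-1$ is nilpotent). Consequently the number of $z$-classes of unipotent elements in $U(V,B)$ is finite, where two elements $x,y$ of a group $G$ lie in the same $z$-class if their centralizers are conjugate, i.e. $\mathcal Z_G(y)=g\,\mathcal Z_G(x)\,g^{-1}$ for some $g\in G$. -/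

import Mathlib

/-- A perfect field of characteristic different from `2` has property FE if, for every positive
integer `n`, it has only finitely many field extensions of degree `n` up to isomorphism of
extensions. (The finite list of representatives is taken inside an algebraic closure; every
finite extension embeds there, so this is no restriction.) -/
structure HasPropertyFE (K : Type*) [Field K] : Prop where
  perfect : PerfectField K
  char_ne_two : ringChar K ≠ 2
  finite_extensions : ∀ n : ℕ, 0 < n →
    ∃ S : Set (IntermediateField K (AlgebraicClosure K)), S.Finite ∧
      ∀ L : IntermediateField K (AlgebraicClosure K), Module.finrank K L = n →
        ∃ M ∈ S, Nonempty (L ≃ₐ[K] M)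

/-- The subfield of elements fixed by a field automorphism `σ`. -/
def fixedSubfield {F : Type*} [Field F] (σ : F ≃+* F) : Subfield F :=
  (σ : F →+* F).eqLocusField (RingHom.id F)

theorem mem_fixedSubfield {F : Type*} [Field F] (σ : F ≃+* F) (a : F) :
    a ∈ fixedSubfield σ ↔ σ a = a := Iff.rfl

/-- A form, linear in the first and `σ`-semilinear in the second variable, is hermitian if
`B u v = σ (B v u)`. -/
def IsHermitianForm {F V : Type*} [Field F] [AddCommGroup V] [Module F V] {σ : F ≃+* F}
    (B : V →ₗ[F] V →ₛₗ[(σ : F →+* F)] F) : Prop :=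
  ∀ u v : V, B u v = σ (B v u)

/-- The group of invertible linear maps preserving the form `B`. -/
def unitaryGroupOf {F V : Type*} [Field F] [AddCommGroup V] [Module F V] {σ : F ≃+* F}
    (B : V →ₗ[F] V →ₛₗ[(σ : F →+* F)] F) : Subgroup (V ≃ₗ[F] V) where
  carrier := {g | ∀ u v : V, B u v = B (g u) (g v)}
  one_mem' := fun _ _ => rfl
  mul_mem' := fun {g h} hg hh u v => (hh u v).trans (hg (h u) (h v))
  inv_mem' := fun {g} hg u v => by
    have h := hg (g.symm u) (g.symm v)
    rw [g.apply_symm_apply, g.apply_symm_apply] at h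
    exact h.symm

/-- An invertible linear map `g` is unipotent if `g - 1` is nilpotent. -/
def IsUnipotentMap {F V : Type*} [Field F] [AddCommGroup V] [Module F V]
    (g : V ≃ₗ[F] V) : Prop :=
  IsNilpotent ((g : V →ₗ[F] V) - LinearMap.id : Module.End F V)

/-- Two elements of a group are `z`-equivalent if their centralizers are conjugate:
`Z(y) = g Z(x) g⁻¹` for some `g`. -/
def ZEquiv {G : Type*} [Group G] (x y : G) : Prop :=
  ∃ g : G, Subgroup.centralizer {y} =
    (Subgroup.centralizer {x}).map (MulAut.conj g).toMonoidHom

theorem zEquiv_equivalence (G : Type*) [Group G] : Equivalence (ZEquiv (G := G)) where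
  refl x := ⟨1, by
    ext a
    simp [Subgroup.mem_map]⟩
  symm := by
    rintro x y ⟨g, hg⟩
    refine ⟨g⁻¹, ?_⟩
    rw [hg, Subgroup.map_map]
    ext a
    simp [Subgroup.mem_map, mul_assoc]
  trans := by
    rintro x y z ⟨g, hg⟩ ⟨h, hh⟩
    refine ⟨h * g, ?_⟩
    rw [hh, hg, Subgroup.map_map]
    congr 1
    ext a
    simp [mul_assoc]

/-- The equivalence relation whose classes are the `z`-classes of `G`. -/
def zSetoid (G : Type*) [Group G] : Setoid G := ⟨ZEquiv, zEquiv_equivalence G⟩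

/-- The type of `z`-classes of `G`. -/
def ZClasses (G : Type*) [Group G] : Type _ := Quotient (zSetoid G)

/-- The `z`-class of an element. -/
def ZClasses.mk {G : Type*} [Group G] (x : G) : ZClasses G := Quotient.mk (zSetoid G) x

/-! The Cayley transform turns a unipotent isometry `g` into a nilpotent map `A = ε(1 - g)(1 +
g)⁻¹`, self-adjoint because `σ ε = -ε`, from which `g` can be recovered
(`exists_selfAdjoint_nilpotent`). For such an `A`, the space is an orthogonal sum of cyclic
subspaces, each with antidiagonal Gram matrix of constant entry `c` (`exists_cyclicDecomposition`).
Rescaling a generator by a fixed scalar `s` changes `c` by `s ^ 2`, so `c` can be taken from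
representatives of the square classes of the fixed field; FE in degree 2 makes these finite in
number. The block sizes and the entries `c` determine `A` up to isometry
(`IsCyclicDecomposition.exists_isometry`), and there are finitely many choices. Conjugate elements
have conjugate centralizers, which gives the `z`-classes. -/

/-! ### Square classes and quadratic extensions -/

open Polynomial in
theorem finrank_adjoin_sqrt {K L : Type*} [Field K] [Field L] [Algebra K L] {x : K} {α : L}
    (hx : ¬ IsSquare x) (hα : α ^ 2 = algebraMap K L x) :
    Module.finrank K (IntermediateField.adjoin K {α}) = 2 := by
  have hirr : Irreducible (X ^ 2 - C x : K[X]) := by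
    refine (X_pow_sub_C_irreducible_iff_of_prime Nat.prime_two).2 ?_
    intro b hb
    exact hx ⟨b, by rw [← hb, sq]⟩
  have hmon : (X ^ 2 - C x : K[X]).Monic := monic_X_pow_sub_C x two_ne_zero
  have hev : aeval α (X ^ 2 - C x : K[X]) = 0 := by simp [hα]
  have hint : IsIntegral K α := ⟨_, hmon, by simpa [aeval_def] using hev⟩
  rw [IntermediateField.adjoin.finrank hint, ← minpoly.eq_of_irreducible_of_monic hirr hev hmon]
  exact natDegree_X_pow_sub_C

/-- Write `α = a + bβ` and square: since `β` is not in `K`, the cross term `2ab` vanishes, and `b =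
0` would make `x` a square. So a quadratic extension determines its square class. -/
theorem exists_sq_mul_of_sqrt_mem {K L : Type*} [Field K] [Field L] [Algebra K L]
    (h2 : (2 : K) ≠ 0) (hL : Module.finrank K L = 2) {x y : K} {α β : L}
    (hx : ¬ IsSquare x) (hy : ¬ IsSquare y)
    (hα : α ^ 2 = algebraMap K L x) (hβ : β ^ 2 = algebraMap K L y) :
    ∃ s : K, x = s ^ 2 * y := by
  have hnot : ∀ t : K, algebraMap K L t ≠ β := by
    rintro t rfl
    exact hy ⟨t, (algebraMap K L).injective (by rw [← hβ, map_mul, sq])⟩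
  have hli : LinearIndependent K ![(1 : L), β] := by
    rw [LinearIndependent.pair_iff]
    intro s t hst
    have ht : t = 0 := by
      by_contra ht
      refine hnot (-s / t) ?_
      have ht' : algebraMap K L t ≠ 0 := by simpa using ht
      rw [map_div₀, map_neg, div_eq_iff ht']
      rw [Algebra.smul_def, Algebra.smul_def] at hst
      linear_combination -hst
    subst ht
    refine ⟨?_, rfl⟩
    simpa [Algebra.smul_def] using hst
  have hspan := hli.span_eq_top_of_card_eq_finrank (by simp [hL])
  have hmem : α ∈ Submodule.span K (Set.range ![(1 : L), β]) := hspan ▸ Submodule.mem_top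
  rw [Matrix.range_cons_cons_empty, Submodule.mem_span_pair] at hmem
  obtain ⟨a, b, hab⟩ := hmem
  rw [Algebra.smul_def, Algebra.smul_def, mul_one] at hab
  have key : algebraMap K L (x - a ^ 2 - b ^ 2 * y) = algebraMap K L (2 * a * b) * β := by
    simp only [map_sub, map_mul, map_pow, map_ofNat]
    rw [← hα, ← hβ, ← hab]
    ring
  have hz : 2 * a * b = 0 := by
    by_contra hne
    have hne' : algebraMap K L (2 * a * b) ≠ 0 := by simpa using hne
    refine hnot ((x - a ^ 2 - b ^ 2 * y) / (2 * a * b)) ?_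
    rw [map_div₀, div_eq_iff hne', key, mul_comm]
  rw [hz, map_zero, zero_mul, map_eq_zero] at key
  rcases mul_eq_zero.1 hz with h | h
  · have ha : a = 0 := by simpa [h2] using h
    subst ha
    exact ⟨b, by linear_combination key⟩
  · subst h
    exact absurd ⟨a, by linear_combination key⟩ hx

theorem HasPropertyFE.two_ne_zero {K : Type*} [Field K] (h : HasPropertyFE K) : (2 : K) ≠ 0 :=
  Ring.two_ne_zero h.char_ne_two

/-- A field with property FE has only finitely many square classes. -/
theorem HasPropertyFE.exists_finite_squareClasses {K : Type*} [Field K] (h : HasPropertyFE K) :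
    ∃ R : Set K, R.Finite ∧ (1 : K) ∈ R ∧
      ∀ x : K, x ≠ 0 → ∃ r ∈ R, ∃ s : K, s ≠ 0 ∧ x = s ^ 2 * r := by
  obtain ⟨S, hS, hSrep⟩ := h.finite_extensions 2 (by norm_num)
  have hr : ∀ M : IntermediateField K (AlgebraicClosure K), ∃ r : K, ∀ x : K, ¬ IsSquare x →
      Module.finrank K M = 2 → (∃ α : M, α ^ 2 = algebraMap K M x) → ∃ s : K, x = s ^ 2 * r := by
    intro M
    -- Any nonsquare with a root in `M` can represent its class; the value 1 in the other case is a
    -- dummy.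
    by_cases hM : ∃ y : K, ¬ IsSquare y ∧ ∃ β : M, β ^ 2 = algebraMap K M y
    · obtain ⟨y, hy, β, hβ⟩ := hM
      refine ⟨y, fun x hx hfin ⟨α, hα⟩ => ?_⟩
      exact exists_sq_mul_of_sqrt_mem h.two_ne_zero hfin hx hy hα hβ
    · exact ⟨1, fun x hx _ hα => (hM ⟨x, hx, hα⟩).elim⟩
  choose r hr using hr
  refine ⟨insert 1 (r '' S), (hS.image r).insert 1, Set.mem_insert _ _, fun x hx0 => ?_⟩
  by_cases hx : IsSquare x
  · obtain ⟨s, rfl⟩ := hx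
    exact ⟨1, Set.mem_insert _ _, s, left_ne_zero_of_mul hx0, by ring⟩
  · obtain ⟨α, hα⟩ := IsAlgClosed.exists_pow_nat_eq
      (algebraMap K (AlgebraicClosure K) x) (n := 2) (by norm_num)
    have hfin := finrank_adjoin_sqrt hx hα
    obtain ⟨M, hMS, ⟨e⟩⟩ := hSrep _ hfin
    obtain ⟨s, hs⟩ := hr M x hx (by rw [← e.toLinearEquiv.finrank_eq, hfin])
      ⟨e ⟨α, IntermediateField.mem_adjoin_simple_self K α⟩, by
        rw [← map_pow, ← e.commutes]
        congr 1
        exact Subtype.ext hα⟩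
    refine ⟨r M, Set.mem_insert_of_mem _ ⟨M, hMS, rfl⟩, s, ?_, hs⟩
    rintro rfl
    exact hx0 (by simpa using hs)

/-! ### Cyclic decomposition of self-adjoint nilpotent maps -/

section Forms

variable {F V : Type*} [Field F] {σ : F ≃+* F} [AddCommGroup V] [Module F V]
  {B : V →ₗ[F] V →ₛₗ[(σ : F →+* F)] F}

/-- `A` is self-adjoint with respect to `B`. -/
def IsSelfAdjointFor (B : V →ₗ[F] V →ₛₗ[(σ : F →+* F)] F) (A : Module.End F V) : Prop :=
  ∀ u v : V, B (A u) v = B u (A v)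

theorem IsSelfAdjointFor.pow_apply {A : Module.End F V} (hA : IsSelfAdjointFor B A) (n : ℕ) :
    ∀ u v : V, B ((A ^ n) u) v = B u ((A ^ n) v) := by
  induction n with
  | zero => intro u v; rfl
  | succ n ih =>
    intro u v
    rw [pow_succ', Module.End.mul_apply, hA, ih, ← Module.End.mul_apply, ← pow_succ, pow_succ']

theorem IsSelfAdjointFor.pow_pow_apply {A : Module.End F V} (hA : IsSelfAdjointFor B A)
    (a b : ℕ) (u v : V) : B ((A ^ a) u) ((A ^ b) v) = B ((A ^ (a + b)) u) v := by
  rw [← hA.pow_apply, ← Module.End.mul_apply, ← pow_add, add_comm]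

/-- Two surjections onto a nondegenerate hermitian space that pull the form back to the same form
differ by an isometry. -/
theorem exists_isometry_of_pullback_eq {M : Type*} [AddCommGroup M] [Module F M]
    (hB : B.SeparatingLeft) (f f' : M →ₗ[F] V)
    (hf : Function.Surjective f) (hf' : Function.Surjective f')
    (h : ∀ x y, B (f x) (f y) = B (f' x) (f' y)) :
    ∃ g ∈ unitaryGroupOf B, ∀ x, g (f x) = f' x := by
  -- The kernel is the radical of the pulled-back form, hence the same for both maps.
  have hker : ∀ (φ : M →ₗ[F] V), Function.Surjective φ → ∀ x,
      x ∈ LinearMap.ker φ ↔ ∀ y, B (φ x) (φ y) = 0 := by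
    intro φ hφ x
    rw [LinearMap.mem_ker]
    refine ⟨fun hx y => by simp [hx], fun hx => hB _ fun v => ?_⟩
    obtain ⟨y, rfl⟩ := hφ v
    exact hx y
  have hk : LinearMap.ker f = LinearMap.ker f' := by
    ext x
    rw [hker f hf, hker f' hf']
    simp only [h]
  let g : V ≃ₗ[F] V := (f.quotKerEquivOfSurjective hf).symm.trans
    ((Submodule.quotEquivOfEq _ _ hk).trans (f'.quotKerEquivOfSurjective hf'))
  have hg : ∀ x, g (f x) = f' x := by
    intro x
    have : (f.quotKerEquivOfSurjective hf).symm (f x) = Submodule.Quotient.mk x := by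
      rw [LinearEquiv.symm_apply_eq]
      rfl
    simp only [g, LinearEquiv.trans_apply, this]
    rfl
  refine ⟨g, fun u v => ?_, hg⟩
  obtain ⟨x, rfl⟩ := hf u
  obtain ⟨y, rfl⟩ := hf v
  rw [hg, hg, h]

/-- The vectors `w i` generate `V` under `A`, in mutually orthogonal cyclic subspaces of
dimension `k i` on which the form is antidiagonal with constant entry `c i`. -/
structure IsCyclicDecomposition {ι : Type*} (B : V →ₗ[F] V →ₛₗ[(σ : F →+* F)] F)
    (A : Module.End F V) (k : ι → ℕ) (c : ι → F) (w : ι → V) : Prop where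
  gram : ∀ i j a b, ((i = j ∧ a + b + 1 = k i) → B ((A ^ a) (w i)) ((A ^ b) (w j)) = c i) ∧
    (¬ (i = j ∧ a + b + 1 = k i) → B ((A ^ a) (w i)) ((A ^ b) (w j)) = 0)
  span_eq_top : Submodule.span F (Set.range fun p : ι × ℕ => (A ^ p.2) (w p.1)) = ⊤

/-- The free module on `ι × ℕ` maps onto `V` through either family of vectors, and the pulled-back
form depends only on `k` and `c`. -/
theorem IsCyclicDecomposition.exists_isometry {ι : Type*} {A A' : Module.End F V}
    {k : ι → ℕ} {c : ι → F} {w w' : ι → V} (hB : B.SeparatingLeft)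
    (h : IsCyclicDecomposition B A k c w) (h' : IsCyclicDecomposition B A' k c w') :
    ∃ g ∈ unitaryGroupOf B, ∀ v, g (A v) = A' (g v) := by
  have hsurj : ∀ {T : Module.End F V} {z : ι → V}, IsCyclicDecomposition B T k c z →
      Function.Surjective
        (Finsupp.linearCombination F fun p : ι × ℕ => (T ^ p.2) (z p.1)) := by
    intro T z hz
    rw [← LinearMap.range_eq_top, Finsupp.range_linearCombination, hz.span_eq_top]
  obtain ⟨g, hg, hgf⟩ := exists_isometry_of_pullback_eq hB _ _ (hsurj h) (hsurj h') (by
    intro x y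
    simp only [Finsupp.linearCombination_apply, Finsupp.sum, map_sum, LinearMap.sum_apply,
      map_smul, LinearMap.smul_apply, LinearMap.map_smulₛₗ]
    refine Finset.sum_congr rfl fun q _ => ?_
    congr 1
    refine Finset.sum_congr rfl fun p _ => ?_
    congr 1
    by_cases hpq : p.1 = q.1 ∧ p.2 + q.2 + 1 = k p.1
    · rw [(h.gram _ _ _ _).1 hpq, (h'.gram _ _ _ _).1 hpq]
    · rw [(h.gram _ _ _ _).2 hpq, (h'.gram _ _ _ _).2 hpq])
  have hgw : ∀ i a, g ((A ^ a) (w i)) = (A' ^ a) (w' i) := by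
    intro i a
    simpa using hgf (Finsupp.single (i, a) 1)
  refine ⟨g, hg, fun v => ?_⟩
  have hEq : (g : V →ₗ[F] V) ∘ₗ A = A' ∘ₗ (g : V →ₗ[F] V) := by
    refine LinearMap.ext_on_range h.span_eq_top ?_
    rintro ⟨i, a⟩
    simp only [LinearMap.comp_apply, LinearEquiv.coe_coe, hgw]
    rw [← Module.End.mul_apply, ← pow_succ', hgw, ← Module.End.mul_apply, ← pow_succ']
  exact LinearMap.congr_fun hEq v

theorem pow_apply_mem {A : Module.End F V} {W : Submodule F V} (hWA : ∀ u ∈ W, A u ∈ W)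
    (n : ℕ) {u : V} (hu : u ∈ W) : (A ^ n) u ∈ W := by
  induction n with
  | zero => exact hu
  | succ n ih =>
    rw [pow_succ', Module.End.mul_apply]
    exact hWA _ ih

theorem exists_self_ne_zero (hσ_ne : ∃ a : F, σ a ≠ a)
    {A : Module.End F V} {W : Submodule F V} {m : ℕ} {u v : V}
    (hu : u ∈ W) (hv : v ∈ W) (huv : B ((A ^ m) u) v ≠ 0) :
    ∃ w ∈ W, B ((A ^ m) w) w ≠ 0 := by
  by_contra! hall
  obtain ⟨t, ht⟩ := hσ_ne
  -- Polarization; comparing `s = 1` with an `s` moved by `σ` isolates the first term.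
  have key : ∀ s : F, σ s * B ((A ^ m) u) v + s * B ((A ^ m) v) u = 0 := by
    intro s
    have h := hall (u + s • v) (W.add_mem hu (W.smul_mem s hv))
    simp only [map_add, map_smul, LinearMap.add_apply, LinearMap.smul_apply,
      LinearMap.map_smulₛₗ, smul_eq_mul, RingHom.coe_coe, hall u hu, hall v hv] at h
    linear_combination h
  have h1 := key 1
  have ht' := key t
  rw [map_one] at h1
  have : (σ t - t) * B ((A ^ m) u) v = 0 := by linear_combination ht' - t * h1
  rcases mul_eq_zero.1 this with h | h
  · exact ht (sub_eq_zero.1 h)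
  · exact huv h

theorem map_self_pow (hB : IsHermitianForm B) {A : Module.End F V} (hA : IsSelfAdjointFor B A)
    (n : ℕ) (w : V) : σ (B ((A ^ n) w) w) = B ((A ^ n) w) w := by
  rw [← hB, hA.pow_apply]

/-- Successive corrections `w + t A ^ (r + 1) w` clear one more entry each: those already treated
change only by terms with powers of `A` above `m`, which vanish. -/
theorem exists_antidiagonal (hB : IsHermitianForm B) (h2 : (2 : F) ≠ 0)
    {A : Module.End F V} (hA : IsSelfAdjointFor B A) {W : Submodule F V}
    (hWA : ∀ u ∈ W, A u ∈ W) {m : ℕ} (hm : ∀ u ∈ W, (A ^ (m + 1)) u = 0)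
    {w₀ : V} (hw₀ : w₀ ∈ W) (hne : B ((A ^ m) w₀) w₀ ≠ 0) (r : ℕ) :
    ∃ w ∈ W, B ((A ^ m) w) w ≠ 0 ∧
      ∀ j, 0 < j → j ≤ r → j ≤ m → B ((A ^ (m - j)) w) w = 0 := by
  induction r with
  | zero => exact ⟨w₀, hw₀, hne, fun j h1 h2 => by omega⟩
  | succ r ih =>
    obtain ⟨w, hw, hwne, hwz⟩ := ih
    by_cases hrm : r + 1 ≤ m
    swap
    · exact ⟨w, hw, hwne, fun j h0 h1 h2 => hwz j h0 (by omega) h2⟩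
    have hWpow := fun n u hu => pow_apply_mem hWA n (u := u) hu
    have hbig : ∀ n, m < n → (A ^ n) w = 0 := by
      intro n hn
      obtain ⟨d, rfl⟩ := Nat.exists_eq_add_of_le (show m + 1 ≤ n from hn)
      rw [add_comm, pow_add, Module.End.mul_apply, hm w hw, map_zero]
    -- Solves the linear equation for the entry at `m - (r + 1)`; the quadratic term in `t`
    -- vanishes.
    set t : F := -(B ((A ^ (m - (r + 1))) w) w) / (2 * B ((A ^ m) w) w) with ht
    have hσt : σ t = t := by
      rw [ht, map_div₀, map_neg, map_mul, map_self_pow hB hA, map_self_pow hB hA, map_ofNat]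
    have hform : ∀ n, B ((A ^ n) (w + t • (A ^ (r + 1)) w)) (w + t • (A ^ (r + 1)) w) =
        B ((A ^ n) w) w + 2 * t * B ((A ^ (n + (r + 1))) w) w +
          t ^ 2 * B ((A ^ (n + (r + 1) + (r + 1))) w) w := by
      intro n
      simp only [map_add, map_smul, LinearMap.add_apply, LinearMap.smul_apply,
        LinearMap.map_smulₛₗ, smul_eq_mul, RingHom.coe_coe, hσt, hA.pow_pow_apply,
        ← Module.End.mul_apply, ← pow_add]
      ring
    refine ⟨w + t • (A ^ (r + 1)) w, W.add_mem hw (W.smul_mem _ (hWpow _ _ hw)), ?_, ?_⟩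
    · rw [hform, hbig (m + (r + 1)) (by omega), hbig (m + (r + 1) + (r + 1)) (by omega)]
      simpa using hwne
    · intro j h0 hj hjm
      rw [hform, hbig (m - j + (r + 1) + (r + 1)) (by omega)]
      rcases Nat.lt_or_ge j (r + 1) with hlt | hge
      · rw [hbig (m - j + (r + 1)) (by omega), hwz j h0 (by omega) hjm]
        simp
      · obtain rfl : j = r + 1 := le_antisymm hj hge
        rw [Nat.sub_add_cancel hrm, ht]
        simp only [map_zero, LinearMap.zero_apply]
        field_simp
        ring

/-- A nonzero nondegenerate `A`-stable subspace contains a vector generating a nondegenerate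
cyclic subspace, with normalised antidiagonal Gram matrix. -/
theorem exists_cyclic_vector (hB : IsHermitianForm B) (h2 : (2 : F) ≠ 0)
    (hσ_ne : ∃ a : F, σ a ≠ a) {R : Set F}
    (hR : ∀ x : F, σ x = x → x ≠ 0 → ∃ r ∈ R, ∃ s : F, σ s = s ∧ s ≠ 0 ∧ x = s ^ 2 * r)
    {A : Module.End F V} (hA : IsSelfAdjointFor B A) {N : ℕ} (hN : A ^ N = 0)
    {W : Submodule F V} (hW : W ≠ ⊥) (hWA : ∀ u ∈ W, A u ∈ W)
    (hWnd : ∀ u ∈ W, (∀ v ∈ W, B u v = 0) → u = 0) :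
    ∃ w ∈ W, ∃ m < N, ∃ c ∈ R, c ≠ 0 ∧ (A ^ (m + 1)) w = 0 ∧
      (∀ n, n = m → B ((A ^ n) w) w = c) ∧ (∀ n, n ≠ m → B ((A ^ n) w) w = 0) := by
  classical
  have hex : ∃ k, ∀ u ∈ W, (A ^ k) u = 0 := ⟨N, fun u _ => by rw [hN]; rfl⟩
  obtain ⟨k, hk, hkmin⟩ : ∃ k, (∀ u ∈ W, (A ^ k) u = 0) ∧
      ∀ l < k, ¬ ∀ u ∈ W, (A ^ l) u = 0 :=
    ⟨Nat.find hex, Nat.find_spec hex, fun l hl => Nat.find_min hex hl⟩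
  have hkN : k ≤ N := by
    by_contra hlt
    exact hkmin N (by omega) fun u _ => by rw [hN]; rfl
  obtain _ | m := k
  · exact (hW ((Submodule.eq_bot_iff W).2 hk)).elim
  have hWpow := fun n u hu => pow_apply_mem hWA n (u := u) hu
  have h := hkmin m (Nat.lt_succ_self m)
  push Not at h
  obtain ⟨u, hu, hune⟩ := h
  obtain ⟨v, hv, hvne⟩ : ∃ v ∈ W, B ((A ^ m) u) v ≠ 0 := by
    by_contra! hcon
    exact hune (hWnd _ (hWpow m u hu) hcon)
  obtain ⟨w₀, hw₀, hw₀ne⟩ := exists_self_ne_zero hσ_ne hu hv hvne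
  obtain ⟨w, hw, hwne, hwz⟩ := exists_antidiagonal hB h2 hA hWA hk hw₀ hw₀ne m
  obtain ⟨r, hr, s, hσs, hs, hsr⟩ := hR _ (map_self_pow hB hA m w) hwne
  have hscale : ∀ n, B ((A ^ n) (s⁻¹ • w)) (s⁻¹ • w) = s⁻¹ ^ 2 * B ((A ^ n) w) w := by
    intro n
    simp only [map_smul, LinearMap.smul_apply, LinearMap.map_smulₛₗ, smul_eq_mul,
      RingHom.coe_coe, map_inv₀, hσs]
    ring
  refine ⟨s⁻¹ • w, W.smul_mem _ hw, m, by omega, r, hr, ?_, ?_, ?_, ?_⟩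
  · rintro rfl
    exact hwne (by simpa using hsr)
  · rw [map_smul, hk w hw, smul_zero]
  · rintro n rfl
    rw [hscale, hsr]
    field_simp
  · intro n hn
    rw [hscale]
    rcases Nat.lt_or_ge n m with hlt | hge
    · have := hwz (m - n) (by omega) (by omega) (by omega)
      rw [Nat.sub_sub_self hlt.le] at this
      rw [this, mul_zero]
    · obtain ⟨d, rfl⟩ := Nat.exists_eq_add_of_le (show m + 1 ≤ n by omega)
      rw [add_comm, pow_add, Module.End.mul_apply, hk w hw]
      simp

theorem exists_cyclicDecomposition_submodule [FiniteDimensional F V]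
    (hB : IsHermitianForm B) (h2 : (2 : F) ≠ 0)
    (hσ_ne : ∃ a : F, σ a ≠ a) {R : Set F} (h1R : (1 : F) ∈ R)
    (hR : ∀ x : F, σ x = x → x ≠ 0 → ∃ r ∈ R, ∃ s : F, σ s = s ∧ s ≠ 0 ∧ x = s ^ 2 * r)
    {A : Module.End F V} (hA : IsSelfAdjointFor B A) {N : ℕ} (hN : A ^ N = 0) (n : ℕ) :
    ∀ W : Submodule F V, Module.finrank F W ≤ n → (∀ u ∈ W, A u ∈ W) →
      (∀ u ∈ W, (∀ v ∈ W, B u v = 0) → u = 0) →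
      ∃ (k : Fin n → ℕ) (c : Fin n → F) (w : Fin n → V),
        (∀ i, k i < N + 1) ∧ (∀ i, c i ∈ R) ∧ (∀ i, w i ∈ W) ∧
        (∀ i j a b, ((i = j ∧ a + b + 1 = k i) → B ((A ^ a) (w i)) ((A ^ b) (w j)) = c i) ∧
          (¬ (i = j ∧ a + b + 1 = k i) → B ((A ^ a) (w i)) ((A ^ b) (w j)) = 0)) ∧
        W ≤ Submodule.span F (Set.range fun p : Fin n × ℕ => (A ^ p.2) (w p.1)) := by
  induction n with
  | zero =>
    intro W hWn _ _
    obtain rfl : W = ⊥ := Submodule.finrank_eq_zero.1 (by omega)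
    exact ⟨Fin.elim0, Fin.elim0, Fin.elim0, fun i => i.elim0, fun i => i.elim0,
      fun i => i.elim0, fun i => i.elim0, bot_le⟩
  | succ n ih =>
    intro W hWn hWA hWnd
    by_cases hW : W = ⊥
    · subst hW
      -- Blocks of size 0 pad the index set to fixed length, so the invariants lie in one finite
      -- type.
      exact ⟨fun _ => 0, fun _ => 1, fun _ => 0, fun _ => by simp, fun _ => h1R,
        fun _ => Submodule.zero_mem _, fun _ _ _ _ => ⟨fun h => by simp at h, fun _ => by simp⟩,
        bot_le⟩
    obtain ⟨w, hw, m, hmN, c, hc, hc0, hwm, hcm, hcz⟩ :=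
      exists_cyclic_vector hB h2 hσ_ne hR hA hN hW hWA hWnd
    have hWpow := fun n u hu => pow_apply_mem hWA n (u := u) hu
    let W' : Submodule F V :=
      { carrier := {v | v ∈ W ∧ ∀ a, B v ((A ^ a) w) = 0}
        zero_mem' := ⟨W.zero_mem, fun a => by simp⟩
        add_mem' := fun {x y} hx hy => ⟨W.add_mem hx.1 hy.1, fun a => by
          rw [map_add, LinearMap.add_apply, hx.2, hy.2, add_zero]⟩
        smul_mem' := fun t x hx => ⟨W.smul_mem t hx.1, fun a => by
          rw [map_smul, LinearMap.smul_apply, hx.2, smul_zero]⟩ }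
    have hW'W : W' ≤ W := fun v hv => hv.1
    have hwW' : w ∉ W' := fun h => hc0 (by
      rw [← hcm m rfl, hA.pow_apply]
      exact h.2 m)
    have hlt : W' < W := lt_of_le_of_ne hW'W fun h => hwW' (h ▸ hw)
    have hflt := Submodule.finrank_lt_finrank_of_lt hlt
    -- Orthogonal projection onto the cyclic span of `w`: up to the factor `c⁻¹`, the vector dual to
    -- `A ^ a w` is `A ^ (m - a) w`.
    let p : V → V := fun v =>
      ∑ a ∈ Finset.range (m + 1), (c⁻¹ * B v ((A ^ (m - a)) w)) • (A ^ a) w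
    have hpW : ∀ v, p v ∈ W := fun v =>
      W.sum_mem fun a _ => W.smul_mem _ (hWpow a w hw)
    have hwbig : ∀ b, m < b → (A ^ b) w = 0 := by
      intro b hb
      obtain ⟨d, rfl⟩ := Nat.exists_eq_add_of_le (show m + 1 ≤ b from hb)
      rw [add_comm, pow_add, Module.End.mul_apply, hwm, map_zero]
    have hsub : ∀ v ∈ W, v - p v ∈ W' := by
      refine fun v hv => ⟨W.sub_mem hv (hpW v), fun b => ?_⟩
      rcases Nat.lt_or_ge m b with hmb | hbm
      · rw [hwbig b hmb, map_zero]
      simp only [p, map_sub, LinearMap.sub_apply, map_sum, LinearMap.sum_apply, map_smul,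
        LinearMap.smul_apply, smul_eq_mul, hA.pow_pow_apply]
      rw [Finset.sum_eq_single (m - b)]
      · rw [hcm _ (by omega), Nat.sub_sub_self hbm]
        field_simp
        ring
      · intro a _ hab
        rw [hcz _ (by omega), mul_zero]
      · intro h
        exact (h (Finset.mem_range.2 (by omega))).elim
    have hW'A : ∀ u ∈ W', A u ∈ W' := fun u hu => ⟨hWA u hu.1, fun a => by
      rw [hA, ← Module.End.mul_apply, ← pow_succ']
      exact hu.2 _⟩
    have hW'nd : ∀ u ∈ W', (∀ v ∈ W', B u v = 0) → u = 0 := by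
      refine fun u hu huv => hWnd u hu.1 fun v hv => ?_
      have hup : B u (p v) = 0 := by
        simp only [p, map_sum, LinearMap.map_smulₛₗ, hu.2, smul_zero, Finset.sum_const_zero]
      rw [← sub_add_cancel v (p v), map_add, hup, add_zero]
      exact huv _ (hsub v hv)
    obtain ⟨k, d, z, hkN, hdR, hzW, hgram, hspan⟩ := ih W' (by omega) hW'A hW'nd
    have hzw : ∀ j a b, B ((A ^ a) (z j)) ((A ^ b) w) = 0 := fun j a b =>
      (pow_apply_mem hW'A a (hzW j)).2 b
    refine ⟨Fin.cons (m + 1) k, Fin.cons c d, Fin.cons w z, ?_, ?_, ?_, ?_, ?_⟩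
    · exact Fin.cases (by simpa using hmN) (by simpa using hkN)
    · exact Fin.cases (by simpa using hc) (by simpa using hdR)
    · exact Fin.cases (by simpa using hw) (by simpa using fun i => hW'W (hzW i))
    · intro i j a b
      cases i using Fin.cases with
      | zero =>
        cases j using Fin.cases with
        | zero =>
          simp only [Fin.cons_zero, hA.pow_pow_apply, true_and]
          exact ⟨fun h => hcm _ (by omega), fun h => hcz _ (by omega)⟩
        | succ j =>
          simp only [Fin.cons_zero, Fin.cons_succ]
          exact ⟨fun h => (Fin.succ_ne_zero j h.1.symm).elim, fun _ => by
            rw [hB, hzw, map_zero]⟩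
      | succ i =>
        cases j using Fin.cases with
        | zero =>
          simp only [Fin.cons_zero, Fin.cons_succ]
          exact ⟨fun h => (Fin.succ_ne_zero i h.1).elim, fun _ => hzw _ _ _⟩
        | succ j =>
          simp only [Fin.cons_succ, Fin.succ_inj]
          exact hgram i j a b
    · intro v hv
      rw [← sub_add_cancel v (p v)]
      refine Submodule.add_mem _ ?_ (Submodule.sum_mem _ fun a _ => Submodule.smul_mem _ _
        (Submodule.subset_span ⟨(0, a), by simp⟩))
      refine Submodule.span_mono ?_ (hspan (hsub v hv))
      rintro _ ⟨⟨i, a⟩, rfl⟩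
      exact ⟨(i.succ, a), by simp⟩

theorem exists_cyclicDecomposition [FiniteDimensional F V]
    (hB : IsHermitianForm B) (hBnd : B.SeparatingLeft) (h2 : (2 : F) ≠ 0)
    (hσ_ne : ∃ a : F, σ a ≠ a) {R : Set F} (h1R : (1 : F) ∈ R)
    (hR : ∀ x : F, σ x = x → x ≠ 0 → ∃ r ∈ R, ∃ s : F, σ s = s ∧ s ≠ 0 ∧ x = s ^ 2 * r)
    {A : Module.End F V} (hA : IsSelfAdjointFor B A) (hnil : IsNilpotent A) :
    ∃ (k : Fin (Module.finrank F V) → Fin (Module.finrank F V + 1))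
      (c : Fin (Module.finrank F V) → R) (w : Fin (Module.finrank F V) → V),
      IsCyclicDecomposition B A (fun i => k i) (fun i => c i) w := by
  have hN : A ^ Module.finrank F V = 0 := by
    simpa [hnil.charpoly_eq_X_pow_finrank] using LinearMap.aeval_self_charpoly A
  obtain ⟨k, c, w, hk, hc, -, hgram, hspan⟩ := exists_cyclicDecomposition_submodule hB h2 hσ_ne
    h1R hR hA hN (Module.finrank F V) ⊤ (by rw [finrank_top]) (fun _ _ => Submodule.mem_top)
    (fun u _ hu => hBnd u fun v => hu v Submodule.mem_top)
  exact ⟨fun i => ⟨k i, hk i⟩, fun i => ⟨c i, hc i⟩, w, hgram, top_le_iff.1 hspan⟩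

/-! ### The Cayley transform -/

theorem IsUnipotentMap.isUnit_one_add (h2 : (2 : F) ≠ 0) {g : V ≃ₗ[F] V} (hg : IsUnipotentMap g) :
    IsUnit (1 + (g : V →ₗ[F] V) : Module.End F V) := by
  have hu : IsUnit (algebraMap F (Module.End F V) 2) := (IsUnit.mk0 _ h2).map _
  have h := IsNilpotent.isUnit_add_left_of_commute hg hu (Algebra.commutes _ _).symm
  have heq : algebraMap F (Module.End F V) 2 + ((g : V →ₗ[F] V) - LinearMap.id) =
      1 + (g : V →ₗ[F] V) := by
    rw [map_ofNat, ← one_add_one_eq_two]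
    change 1 + 1 + ((g : Module.End F V) - 1) = 1 + (g : Module.End F V)
    abel
  exact heq ▸ h

theorem one_sub_mul_of_one_add_mul_eq_one {R : Type*} [Ring R] {a b : R}
    (h : (1 + a) * b = 1) : (1 - a) * b = 2 * b - 1 := by
  rw [add_mul, one_mul] at h
  rw [sub_mul, one_mul, two_mul, ← h]
  abel

theorem mul_one_sub_of_mul_one_add_eq_one {R : Type*} [Ring R] {a b : R}
    (h : b * (1 + a) = 1) : b * (1 - a) = 2 * b - 1 := by
  rw [mul_add, mul_one] at h
  rw [mul_sub, mul_one, two_mul, ← h]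
  abel

/-- The Cayley transform of a unipotent isometry, made self-adjoint by a scalar `ε` with
`σ ε = -ε`, determines the isometry up to conjugation. -/
theorem exists_selfAdjoint_nilpotent (h2 : (2 : F) ≠ 0)
    (hσ : ∀ a : F, σ (σ a) = a) (hσ_ne : ∃ a : F, σ a ≠ a) :
    ∃ Φ : unitaryGroupOf B → Module.End F V,
      (∀ g : unitaryGroupOf B, IsUnipotentMap (g : V ≃ₗ[F] V) →
        IsSelfAdjointFor B (Φ g) ∧ IsNilpotent (Φ g)) ∧
      ∀ g g' h : unitaryGroupOf B, IsUnipotentMap (g : V ≃ₗ[F] V) →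
        IsUnipotentMap (g' : V ≃ₗ[F] V) →
        (∀ v, (h : V ≃ₗ[F] V) (Φ g v) = Φ g' ((h : V ≃ₗ[F] V) v)) → h * g * h⁻¹ = g' := by
  classical
  obtain ⟨t, ht⟩ := hσ_ne
  have hε : t - σ t ≠ 0 := fun h => ht (sub_eq_zero.1 h).symm
  set ε := t - σ t with hεdef
  have hσε : σ ε = -ε := by rw [hεdef, map_sub, hσ]; ring
  let E : unitaryGroupOf B → Module.End F V := fun g => ((g : V ≃ₗ[F] V) : V →ₗ[F] V)
  have hspec : ∀ g : unitaryGroupOf B, IsUnipotentMap (g : V ≃ₗ[F] V) →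
      (1 + E g) * Ring.inverse (1 + E g) = 1 ∧ Ring.inverse (1 + E g) * (1 + E g) = 1 :=
    fun g hg => ⟨Ring.mul_inverse_cancel _ (hg.isUnit_one_add h2),
      Ring.inverse_mul_cancel _ (hg.isUnit_one_add h2)⟩
  refine ⟨fun g => ε • ((1 - E g) * Ring.inverse (1 + E g)), fun g hg => ⟨?_, ?_⟩, ?_⟩
  · obtain ⟨h1, -⟩ := hspec g hg
    intro u v
    -- With `u = x + g x` and `v = y + g y`, self-adjointness reduces to `B x y = B (g x) (g y)`.
    have hu : u = Ring.inverse (1 + E g) u + E g (Ring.inverse (1 + E g) u) :=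
      (LinearMap.congr_fun h1 u).symm
    have hv : v = Ring.inverse (1 + E g) v + E g (Ring.inverse (1 + E g) v) :=
      (LinearMap.congr_fun h1 v).symm
    simp only [LinearMap.smul_apply, Module.End.mul_apply, LinearMap.sub_apply,
      Module.End.one_apply, map_smul, LinearMap.map_smulₛₗ, RingHom.coe_coe, hσε, smul_eq_mul]
    generalize Ring.inverse (1 + E g) u = x at hu ⊢
    generalize Ring.inverse (1 + E g) v = y at hv ⊢
    rw [hu, hv]
    have hxy : B x y = B (E g x) (E g y) := g.2 x y
    simp only [map_sub, map_add, LinearMap.sub_apply, LinearMap.add_apply]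
    linear_combination 2 * ε * hxy
  · obtain ⟨h1, h1'⟩ := hspec g hg
    have hc : Commute (1 - E g) (Ring.inverse (1 + E g)) :=
      (one_sub_mul_of_one_add_mul_eq_one h1).trans (mul_one_sub_of_mul_one_add_eq_one h1').symm
    have hn : IsNilpotent (1 - E g) := by
      rw [← isNilpotent_neg_iff, neg_sub]
      exact hg
    exact (hc.isNilpotent_mul_right hn).smul ε
  · intro g g' h hg hg' hh
    obtain ⟨h1, h1'⟩ := hspec g hg
    obtain ⟨h2', -⟩ := hspec g' hg'
    beta_reduce at hh
    set J := Ring.inverse (1 + E g)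
    set J' := Ring.inverse (1 + E g')
    -- The transform is affine in `J = (1 + g)⁻¹`, so a map intertwining the transforms intertwines
    -- the `J`s, hence the isometries.
    have hJ : (1 - E g) * J = 2 * J - 1 := one_sub_mul_of_one_add_mul_eq_one h1
    have hJ' : (1 - E g') * J' = 2 * J' - 1 := one_sub_mul_of_one_add_mul_eq_one h2'
    have hcomm : E h * J = J' * E h := by
      ext v
      have := hh v
      rw [hJ, hJ'] at this
      simp only [LinearMap.smul_apply, map_smul, LinearMap.sub_apply, map_sub, two_mul,
        LinearMap.add_apply, map_add, Module.End.one_apply] at this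
      have h4 := smul_right_injective V hε this
      have h5 := sub_left_injective h4
      rw [← two_smul F, ← two_smul F] at h5
      exact smul_right_injective V h2 h5
    have hcomm' : E h * E g = E g' * E h := by
      have : (1 + E g') * (E h * J) * (1 + E g) = (1 + E g') * (J' * E h) * (1 + E g) := by
        rw [hcomm]
      rw [mul_assoc, mul_assoc (E h), h1', ← mul_assoc (1 + E g') J', h2', mul_one, one_mul,
        add_mul, mul_add, one_mul, mul_one] at this
      exact (add_left_cancel this).symm
    rw [mul_inv_eq_iff_eq_mul]
    refine Subtype.ext (LinearEquiv.ext fun v => ?_)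
    exact LinearMap.congr_fun hcomm' v

end Forms

/-! ### Finiteness of the classes -/

theorem exists_finite_fixed_squareClasses {F : Type*} [Field F] {σ : F ≃+* F}
    (hFE : HasPropertyFE (fixedSubfield σ)) :
    ∃ R : Set F, R.Finite ∧ (1 : F) ∈ R ∧
      ∀ x : F, σ x = x → x ≠ 0 → ∃ r ∈ R, ∃ s : F, σ s = s ∧ s ≠ 0 ∧ x = s ^ 2 * r := by
  obtain ⟨R, hR, h1, h⟩ := hFE.exists_finite_squareClasses
  refine ⟨Subtype.val '' R, hR.image _, ⟨1, h1, rfl⟩, fun x hx hx0 => ?_⟩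
  obtain ⟨r, hr, s, hs, hxs⟩ := h ⟨x, hx⟩ fun h0 => hx0 (congrArg Subtype.val h0)
  exact ⟨r, ⟨r, hr, rfl⟩, s, s.2, fun h0 => hs (Subtype.ext h0), congrArg Subtype.val hxs⟩

theorem finite_conjClasses_unipotent {F V : Type*} [Field F] (σ : F ≃+* F)
    (hσ : ∀ a : F, σ (σ a) = a) (hσ_ne : ∃ a : F, σ a ≠ a)
    [AddCommGroup V] [Module F V] [FiniteDimensional F V]
    (B : V →ₗ[F] V →ₛₗ[(σ : F →+* F)] F)
    (hB : IsHermitianForm B) (hB_nondeg : B.Nondegenerate)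
    (hFE : HasPropertyFE (fixedSubfield σ)) :
    (ConjClasses.mk '' {g : unitaryGroupOf B | IsUnipotentMap (g : V ≃ₗ[F] V)}).Finite := by
  have h2 : (2 : F) ≠ 0 := fun h => hFE.two_ne_zero (Subtype.ext h)
  obtain ⟨R, hRfin, h1R, hR⟩ := exists_finite_fixed_squareClasses hFE
  obtain ⟨Φ, hΦ, hconj⟩ := exists_selfAdjoint_nilpotent (B := B) h2 hσ hσ_ne
  have : Finite R := hRfin
  have hdec : ∀ g : {g : unitaryGroupOf B | IsUnipotentMap (g : V ≃ₗ[F] V)}, _ := fun g =>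
    exists_cyclicDecomposition hB hB_nondeg.1 h2 hσ_ne h1R hR (hΦ g.1 g.2).1 (hΦ g.1 g.2).2
  choose k c w hw using hdec
  rw [Set.image_eq_range]
  let D := (Fin (Module.finrank F V) → Fin (Module.finrank F V + 1)) ×
    (Fin (Module.finrank F V) → R)
  -- The conjugacy class depends only on the pair `(k, c)` in the finite type `D`.
  have hfactor : Function.FactorsThrough
      (fun g : {g : unitaryGroupOf B | IsUnipotentMap (g : V ≃ₗ[F] V)} => ConjClasses.mk g.1)
      (fun g => ((k g, c g) : D)) := by
    intro g g' hgg'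
    obtain ⟨hk, hc⟩ := Prod.ext_iff.1 hgg'
    simp only at hk hc
    have hg' := hw g'
    rw [← hk, ← hc] at hg'
    obtain ⟨h, hh, hcomm⟩ := (hw g).exists_isometry hB_nondeg.1 hg'
    exact ConjClasses.mk_eq_mk_iff_isConj.2
      (isConj_iff.2 ⟨⟨h, hh⟩, hconj g.1 g'.1 ⟨h, hh⟩ g.2 g'.2 hcomm⟩)
  obtain ⟨φ, hφ⟩ := (Function.factorsThrough_iff _).1 hfactor
  rw [hφ]
  exact (Set.finite_range φ).subset (Set.range_comp_subset_range _ _)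

theorem IsConj.zEquiv {G : Type*} [Group G] {x y : G} (h : IsConj x y) : ZEquiv x y := by
  obtain ⟨g, rfl⟩ := isConj_iff.1 h
  refine ⟨g, ?_⟩
  ext a
  rw [Subgroup.mem_map_equiv, Subgroup.mem_centralizer_singleton_iff,
    Subgroup.mem_centralizer_singleton_iff, MulAut.conj_symm_apply]
  constructor
  · intro ha
    rw [← mul_right_inj g, ← mul_left_inj g⁻¹]
    simpa [mul_assoc] using ha
  · intro ha
    rw [← mul_right_inj g, ← mul_left_inj g⁻¹] at ha
    simpa [mul_assoc] using ha

theorem mainTheorem6 {F V : Type*} [Field F] (σ : F ≃+* F) (hσ : ∀ a : F, σ (σ a) = a)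
    (hσ_ne : ∃ a : F, σ a ≠ a)
    [AddCommGroup V] [Module F V] [FiniteDimensional F V]
    (B : V →ₗ[F] V →ₛₗ[(σ : F →+* F)] F)
    (hB : IsHermitianForm B) (hB_nondeg : B.Nondegenerate)
    (hFE : HasPropertyFE (fixedSubfield σ)) :
    (ConjClasses.mk '' {g : unitaryGroupOf B | IsUnipotentMap (g : V ≃ₗ[F] V)}).Finite ∧
    (ZClasses.mk '' {g : unitaryGroupOf B | IsUnipotentMap (g : V ≃ₗ[F] V)}).Finite := by
  have h := finite_conjClasses_unipotent σ hσ hσ_ne B hB hB_nondeg hFE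
  refine ⟨h, ?_⟩
  let f : ConjClasses (unitaryGroupOf B) → ZClasses (unitaryGroupOf B) :=
    Quotient.lift ZClasses.mk fun _ _ hxy =>
      Quotient.sound (IsConj.zEquiv hxy)
  have hz := h.image f
  rw [Set.image_image] at hz
  exact hz
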